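/- **Model.** A turnstile stream over $[n]$ is a finite sequence of updates $(i,\Delta)\in[n]\times\{-M,\dots,M\}$, where $M\ge 1$ is an integer; its frequency vector $f\in\mathbb{Z}^n$ starts at $0^n$, and $(i,\Delta)$ causes $f_i\leftarrow f_i+\Delta$. An $r$-pass streaming algorithm with $s$ bits of space reads the stream $r$ times in order, its memory between updates being a string in $\{0,1\}^s$, and computes its output in $[n]\cup\{\bot,\mathbf{FAIL}\}$ from the memory after the last pass. It is randomized; access to its random string, to the number of the current pass and to the current position in the stream is not charged (so the lower bounds hold in particular when these are charged or unavailable). Let $G:\mathbb{R}\to\mathbb{R}_{\ge0}$. Such an algorithm is an $(\epsilon,\gamma,\delta)$-approximate $G$-sampler for streams of at most $m$ updates if on each such stream it outputs $\mathbf{FAIL}$ with probability at most $\delta$ and, conditioned on not outputting $\mathbf{FAIL}$: * if $f\ne 0$, then for each $j\in[n]$ it outputs $j$ with a probability between $(1-\epsilon)\frac{G(f_j)}{\sum_k G(f_k)}-\gamma$ and $(1+\epsilon)\frac{G(f_j)}{\sum_k G(f_k)}+\gamma$, and it outputs $\bot$ (whose target probability is $0$) with probability at most $\gamma$; * if $f=0$,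 it outputs $\bot$ with probability at least $1-\delta$. It is truly perfect if $\epsilon=\gamma=0$. **Theorem** (turnstile lower bound). Fix an integer $r\ge1$. 1. For every constant $0\le\epsilon_0<1$ there is $c>0$, depending only on $\epsilon_0$ and $r$, such that the following holds. Let $n\ge 0$ be an integer, let $2^{-n/2}\le\gamma<\frac14$, let $G:\mathbb{R}\to\mathbb{R}_{\ge0}$ be any function with $G(0)=0$ and $G(x)>0$ for $x\ne0$, and let $M\ge1$ and $m\ge 2n$. Then every $r$-pass $(\epsilon_0,\gamma,\frac12)$-approximate $G$-sampler for turnstile streams of at most $m$ updates uses at least $c\cdot\min\{n,\log_2\frac1\gamma\}$ bits of space. 2. In particular, no truly perfect turnstile sampler uses sublinear space: for every $0<\delta<1$ there is $c>0$, depending only on $\delta$ and $r$, such that for all $n\ge 0$, $G$, $M\ge 1$, $m\ge 2n$ as above, every $r$-pass truly perfect ($(0,0,\delta)$-approximate) $G$-sampler for turnstile streams of at most $m$ updates uses at least $c\,n$ bits of space. -/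

import Mathlib

open MeasureTheory ProbabilityTheory
open scoped NNReal

namespace Turnstile

/-- A turnstile stream over the coordinates `[n]`: a finite sequence of updates `(i, Δ)`. -/
abbrev UpdateStream (n : ℕ) : Type := List (Fin n × ℤ)

/-- The streams of the turnstile model: at most `m` updates, each with `Δ ∈ {-M, …, M}`. -/
def IsTurnstile {n : ℕ} (M m : ℕ) (S : UpdateStream n) : Prop :=
  S.length ≤ m ∧ ∀ u ∈ S, -(M : ℤ) ≤ u.2 ∧ u.2 ≤ (M : ℤ)

/-- The frequency vector of a stream: it starts at `0`, and `(i, Δ)` adds `Δ` to coordinate `i`. -/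
def freq {n : ℕ} (S : UpdateStream n) : Fin n → ℤ :=
  fun j => (S.map fun u => if u.1 = j then u.2 else 0).sum

/-- The possible outputs of a sampler: an index in `[n]`, the symbol `⊥`, or `FAIL`. -/
inductive Output (n : ℕ) : Type
  | index (i : Fin n) : Output n
  | bot : Output n
  | fail : Output n

/-- The contents of a memory of `s` bits. -/
abbrev Memory (s : ℕ) : Type := Fin s → Bool

/-- A randomized streaming algorithm whose memory between updates consists of `s` bits.
All its random choices are functions of `ω : Ω`. Only the `s` bits of memory are charged:
the algorithm may consult `ω`, the number of the current pass and the current position in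
the stream for free. In particular it may toss fresh coins at each update
(a separate part of `ω` for each pass and position), and it may also re-read old coins. -/
structure StreamingAlgorithm (Ω : Type*) [MeasurableSpace Ω] (n s : ℕ) where
  /-- initial memory -/
  start : Memory s
  /-- `step ω p t σ u`: the memory after update `u`, the `t`-th of pass `p`, is read in memory
  state `σ` -/
  step : Ω → ℕ → ℕ → Memory s → Fin n × ℤ → Memory s
  /-- the output, computed from the memory at the end of the last pass -/
  out : Ω → Memory s → Output n
  measurableSet_step : ∀ p t σ u σ', MeasurableSet {ω | step ω p t σ u = σ'}
  measurableSet_out : ∀ σ a, MeasurableSet {ω | out ω σ = a}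

namespace StreamingAlgorithm

variable {Ω : Type*} [MeasurableSpace Ω] {n s : ℕ}

/-- Read the updates of a list one after the other, in pass `p`, from position `t` on. -/
def runFrom (A : StreamingAlgorithm Ω n s) (ω : Ω) (p : ℕ) :
    ℕ → Memory s → UpdateStream n → Memory s
  | _, σ, [] => σ
  | t, σ, u :: S => runFrom A ω p (t + 1) (A.step ω p t σ u) S

/-- The memory after a given number of passes over the stream `S`. -/
def memoryAfter (A : StreamingAlgorithm Ω n s) (ω : Ω) (S : UpdateStream n) : ℕ → Memory s
  | 0 => A.start
  | p + 1 => A.runFrom ω p 0 (memoryAfter A ω S p) S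

/-- The output after `r` passes over the stream `S`. -/
def result (A : StreamingAlgorithm Ω n s) (r : ℕ) (S : UpdateStream n) (ω : Ω) : Output n :=
  A.out ω (A.memoryAfter ω S r)

end StreamingAlgorithm

/-- The probability that `A`, after `r` passes over `S`, outputs `a`, conditioned on not
outputting `FAIL`. -/
noncomputable def outputProb {Ω : Type*} [MeasurableSpace Ω] {n s : ℕ} (μ : Measure Ω)
    (A : StreamingAlgorithm Ω n s) (r : ℕ) (S : UpdateStream n) (a : Output n) : ℝ :=
  (μ[|{ω | A.result r S ω ≠ Output.fail}]).real {ω | A.result r S ω = a}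

/-- The target distribution: `G (f j) / ∑ k, G (f k)`. -/
noncomputable def targetProb {n : ℕ} (G : ℝ → ℝ≥0) (f : Fin n → ℤ) (j : Fin n) : ℝ :=
  (G (f j) : ℝ) / ∑ k, (G (f k) : ℝ)

/-- `A` is an `r`-pass `(ε, γ, δ)`-approximate `G`-sampler for turnstile streams of at most `m`
updates with increments in `{-M, …, M}`. It fails with probability at most `δ`. Conditioned on
not failing: if `f ≠ 0`, each index `j` has probability `(1 ± ε) G(f_j) / ∑ G(f_k) ± γ`, and
`⊥`, whose target probability is `0`, has probability at most `γ`; if `f = 0`, the output is `⊥`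
with probability at least `1 - δ`. -/
structure IsApproxSampler {Ω : Type*} [MeasurableSpace Ω] {n s : ℕ} (μ : Measure Ω)
    (A : StreamingAlgorithm Ω n s) (r M m : ℕ) (G : ℝ → ℝ≥0) (ε γ δ : ℝ) : Prop where
  fail_le : ∀ S, IsTurnstile M m S → μ.real {ω | A.result r S ω = Output.fail} ≤ δ
  index_mem : ∀ S, IsTurnstile M m S → freq S ≠ 0 → ∀ j,
    (1 - ε) * targetProb G (freq S) j - γ ≤ outputProb μ A r S (Output.index j) ∧
      outputProb μ A r S (Output.index j) ≤ (1 + ε) * targetProb G (freq S) j + γ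
  bot_le : ∀ S, IsTurnstile M m S → freq S ≠ 0 → outputProb μ A r S Output.bot ≤ γ
  le_bot : ∀ S, IsTurnstile M m S → freq S = 0 → 1 - δ ≤ outputProb μ A r S Output.bot

end Turnstile

namespace Turnstile

/-! ### Splicing of runs, and measurability. -/

namespace StreamingAlgorithm

variable {Ω : Type*} [MeasurableSpace Ω] {n s : ℕ}

/-! A sampler decides equality: the stream encoding `x - y` is answered `⊥` with probability at
least `a = (1 - δ) ^ 2` if `x = y` and at most `γ` otherwise. Fix the random string and colour each
`x` by its transcript on `(x, x)`, the memory at the cut and at the end of every pass; there are `K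
= 2 ^ (2 * r * s)` colours. If `x` and `y` share a colour, the runs can be spliced
(`memoryAfter_splice`), so `(x, y)` gets the answer of `(x, x)`. Few colours thus force many pairs
answered `⊥`, by a Cauchy–Schwarz count. Averaging over the random string gives `a ^ 2 * 2 ^ n ≤ K *
(a + γ * 2 ^ n)` (`transcripts_lower_bound`). Logarithms bound `s` up to an additive constant, which
is absorbed because `s ≥ 1` (`one_le_space`). -/

theorem runFrom_append (A : StreamingAlgorithm Ω n s) (ω : Ω) (p : ℕ) (S T : UpdateStream n) :
    ∀ (t : ℕ) (σ : Memory s), A.runFrom ω p t σ (S ++ T) =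
      A.runFrom ω p (t + S.length) (A.runFrom ω p t σ S) T := by
  induction S with
  | nil => intro t σ; rfl
  | cons u S ih =>
    intro t σ
    simp only [List.cons_append, runFrom, List.length_cons, ih]
    congr 1
    omega

/-- Two runs with the same memory at the cut and at the end of every pass can be spliced. -/
theorem memoryAfter_splice (A : StreamingAlgorithm Ω n s) (ω : Ω) {r : ℕ}
    {S T S' T' : UpdateStream n} (hlen : S.length = S'.length)
    (hcut : ∀ p < r, A.runFrom ω p 0 (A.memoryAfter ω (S ++ T) p) S =
      A.runFrom ω p 0 (A.memoryAfter ω (S' ++ T') p) S')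
    (hend : ∀ p < r, A.memoryAfter ω (S ++ T) (p + 1) = A.memoryAfter ω (S' ++ T') (p + 1)) :
    ∀ p ≤ r, A.memoryAfter ω (S ++ T') p = A.memoryAfter ω (S ++ T) p := by
  intro p
  induction p with
  | zero => intro _; rfl
  | succ p ih =>
    intro hp
    rw [hend p hp]
    simp only [memoryAfter]
    rw [runFrom_append, runFrom_append, ih (by omega), hcut p hp, hlen]

/-- The memory being updated is itself random, so the event is split over its finitely many values.
-/
theorem measurableSet_step_comp (A : StreamingAlgorithm Ω n s) {f : Ω → Memory s}
    (hf : ∀ σ, MeasurableSet {ω | f ω = σ}) (p t : ℕ) (u : Fin n × ℤ) (σ' : Memory s) :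
    MeasurableSet {ω | A.step ω p t (f ω) u = σ'} := by
  have h : {ω | A.step ω p t (f ω) u = σ'} =
      ⋃ σ, ({ω | f ω = σ} ∩ {ω | A.step ω p t σ u = σ'}) := by
    ext ω; simp
  rw [h]
  exact MeasurableSet.iUnion fun σ => (hf σ).inter (A.measurableSet_step p t σ u σ')

theorem measurableSet_runFrom (A : StreamingAlgorithm Ω n s) (p : ℕ) (S : UpdateStream n) :
    ∀ (t : ℕ) (f : Ω → Memory s), (∀ σ, MeasurableSet {ω | f ω = σ}) →
      ∀ σ', MeasurableSet {ω | A.runFrom ω p t (f ω) S = σ'} := by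
  induction S with
  | nil => intro t f hf σ'; exact hf σ'
  | cons u S ih =>
    intro t f hf σ'
    exact ih (t + 1) (fun ω => A.step ω p t (f ω) u) (A.measurableSet_step_comp hf p t u) σ'

theorem measurableSet_memoryAfter (A : StreamingAlgorithm Ω n s) (S : UpdateStream n) (p : ℕ) :
    ∀ σ, MeasurableSet {ω | A.memoryAfter ω S p = σ} := by
  induction p with
  | zero => intro σ; exact MeasurableSet.const (A.start = σ)
  | succ p ih => exact A.measurableSet_runFrom p S 0 _ ih

theorem measurableSet_result (A : StreamingAlgorithm Ω n s) (r : ℕ) (S : UpdateStream n)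
    (a : Output n) : MeasurableSet {ω | A.result r S ω = a} := by
  have h : {ω | A.result r S ω = a} =
      ⋃ σ, ({ω | A.memoryAfter ω S r = σ} ∩ {ω | A.out ω σ = a}) := by
    ext ω; simp [result]
  rw [h]
  exact MeasurableSet.iUnion fun σ =>
    (A.measurableSet_memoryAfter S r σ).inter (A.measurableSet_out σ a)

end StreamingAlgorithm

/-! ### Encoding equality as a stream. -/

section Equality

variable {n : ℕ}

/-- The stream that inserts the 0/1 vector `x` with sign `e`, in one update per coordinate. -/
def bitStream (e : ℤ) (x : Fin n → Bool) : UpdateStream n :=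
  List.ofFn fun i => (i, if x i then e else 0)

theorem length_bitStream (e : ℤ) (x : Fin n → Bool) : (bitStream e x).length = n := by
  simp [bitStream]

theorem freq_append (S T : UpdateStream n) : freq (S ++ T) = freq S + freq T := by
  ext j; simp [freq]

theorem freq_bitStream (e : ℤ) (x : Fin n → Bool) (j : Fin n) :
    freq (bitStream e x) j = if x j then e else 0 := by
  simp [freq, bitStream, List.map_ofFn, List.sum_ofFn, Finset.sum_ite_eq']

/-- The stream encoding the input `(x, y)` of the equality problem: its frequency vector is
`x - y`. -/
def eqStream (x y : Fin n → Bool) : UpdateStream n := bitStream 1 x ++ bitStream (-1) y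

theorem freq_eqStream_eq_zero_iff (x y : Fin n → Bool) : freq (eqStream x y) = 0 ↔ x = y := by
  rw [eqStream, freq_append, funext_iff, funext_iff]
  refine forall_congr' fun j => ?_
  simp only [Pi.add_apply, freq_bitStream, Pi.zero_apply]
  cases x j <;> cases y j <;> simp

theorem isTurnstile_eqStream {M m : ℕ} (hM : 1 ≤ M) (hm : 2 * n ≤ m) (x y : Fin n → Bool) :
    IsTurnstile M m (eqStream x y) := by
  refine ⟨by simp only [eqStream, List.length_append, length_bitStream]; omega, ?_⟩
  intro u hu
  simp only [eqStream, bitStream, List.mem_append, List.mem_ofFn] at hu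
  rcases hu with ⟨i, rfl⟩ | ⟨i, rfl⟩ <;> dsimp only <;> split_ifs <;> omega

end Equality

/-- The pairs of equally coloured points of `D` number at least `2 l |D| - l² |κ|`. -/
theorem two_mul_card_sub_le_card_pairs {X κ : Type*} [Fintype κ] [DecidableEq κ]
    (D : Finset X) (g : X → κ) (l : ℝ) :
    2 * l * (D.card : ℝ) - l ^ 2 * (Fintype.card κ : ℝ) ≤
      (((D ×ˢ D).filter fun z => g z.1 = g z.2).card : ℝ) := by
  classical
  have h1 : (D.card : ℝ) = ∑ k, ((D.filter fun x => g x = k).card : ℝ) := by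
    exact_mod_cast Finset.card_eq_sum_card_fiberwise (f := g) (t := Finset.univ) (by simp)
  have h2 : (((D ×ˢ D).filter fun z => g z.1 = g z.2).card : ℝ) =
      ∑ k, ((D.filter fun x => g x = k).card : ℝ) ^ 2 := by
    rw [Finset.card_eq_sum_card_fiberwise (f := fun z => g z.1) (t := Finset.univ) (by simp)]
    push_cast
    refine Finset.sum_congr rfl fun k _ => ?_
    rw [sq, ← Nat.cast_mul, ← Finset.card_product]
    congr 2
    ext z
    simp only [Finset.mem_filter, Finset.mem_product]
    grind
  have h3 : (Fintype.card κ : ℝ) = ∑ _k : κ, (1 : ℝ) := by simp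
  rw [h2, h1, h3, Finset.mul_sum, Finset.mul_sum, ← Finset.sum_sub_distrib]
  refine Finset.sum_le_sum fun k _ => ?_
  -- Per colour class of size `c`: `2 * l * c - l ^ 2 ≤ c ^ 2`.
  nlinarith [sq_nonneg (((D.filter fun x => g x = k).card : ℝ) - l)]

/-! ### Counting transcripts. -/

variable {Ω : Type*} [MeasurableSpace Ω] {n s : ℕ}

/-- Two inputs with the same transcript, both answered `⊥` on the diagonal, form a pair answered
`⊥`. The free parameter `l` linearises Cauchy–Schwarz, so that the bound survives taking
expectations. -/
theorem StreamingAlgorithm.two_mul_card_bot_sub_le (A : StreamingAlgorithm Ω n s) (r : ℕ) (ω : Ω)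
    (l : ℝ) :
    2 * l * (∑ x, Set.indicator {ω | A.result r (eqStream x x) ω = Output.bot} 1 ω)
        - l ^ 2 * (2 : ℝ) ^ (2 * r * s) ≤
      ∑ x, ∑ y, Set.indicator {ω | A.result r (eqStream x y) ω = Output.bot} 1 ω := by
  classical
  let g : (Fin n → Bool) → (Fin r → Memory s × Memory s) := fun x p =>
    (A.runFrom ω p 0 (A.memoryAfter ω (eqStream x x) p) (bitStream 1 x),
      A.memoryAfter ω (eqStream x x) (p + 1))
  let D : Finset (Fin n → Bool) :=
    Finset.univ.filter fun x => A.result r (eqStream x x) ω = Output.bot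
  have hK : (Fintype.card (Fin r → Memory s × Memory s) : ℝ) = 2 ^ (2 * r * s) := by
    simp only [Fintype.card_fun, Fintype.card_prod, Fintype.card_bool, Fintype.card_fin]
    push_cast
    rw [← pow_add, ← pow_mul]
    congr 1
    ring
  have hD : (∑ x, Set.indicator {ω | A.result r (eqStream x x) ω = Output.bot} (1 : Ω → ℝ) ω) =
      (D.card : ℝ) := by
    simp [D, Set.indicator_apply, Finset.sum_boole]
  have hP : ∑ x, ∑ y, Set.indicator {ω | A.result r (eqStream x y) ω = Output.bot} (1 : Ω → ℝ) ω =
      ((Finset.univ.filter fun z : (Fin n → Bool) × (Fin n → Bool) =>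
        A.result r (eqStream z.1 z.2) ω = Output.bot).card : ℝ) := by
    rw [← Fintype.sum_prod_type']
    simp [Set.indicator_apply, Finset.sum_boole]
  rw [hD, hP, ← hK]
  refine (two_mul_card_sub_le_card_pairs D g l).trans ?_
  refine Nat.cast_le.2 (Finset.card_le_card fun z hz => ?_)
  obtain ⟨x, y⟩ := z
  simp only [D, Finset.mem_filter, Finset.mem_product, Finset.mem_univ, true_and] at hz ⊢
  obtain ⟨⟨hx, -⟩, hg⟩ := hz
  -- Both first halves have length `n`, so the second halves start at the same position in the
  -- stream.
  have hsplice := A.memoryAfter_splice ω (r := r) (S := bitStream 1 x) (T := bitStream (-1) x)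
    (S' := bitStream 1 y) (T' := bitStream (-1) y) (by simp only [length_bitStream])
    (fun p hp => congrArg Prod.fst (congrFun hg ⟨p, hp⟩))
    (fun p hp => congrArg Prod.snd (congrFun hg ⟨p, hp⟩)) r le_rfl
  rw [← hx]
  exact congrArg (A.out ω) hsplice

theorem StreamingAlgorithm.two_mul_sum_prob_bot_sub_le (μ : Measure Ω) [IsProbabilityMeasure μ]
    (A : StreamingAlgorithm Ω n s) (r : ℕ) (l : ℝ) :
    2 * l * (∑ x, μ.real {ω | A.result r (eqStream x x) ω = Output.bot})
        - l ^ 2 * (2 : ℝ) ^ (2 * r * s) ≤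
      ∑ x, ∑ y, μ.real {ω | A.result r (eqStream x y) ω = Output.bot} := by
  have hm := fun x y : Fin n → Bool => A.measurableSet_result r (eqStream x y) Output.bot
  have hi : ∀ x y, Integrable
      (Set.indicator {ω | A.result r (eqStream x y) ω = Output.bot} (1 : Ω → ℝ)) μ :=
    fun x y => (integrable_const (1 : ℝ)).indicator (hm x y)
  have hd : Integrable (fun ω => ∑ x,
      Set.indicator {ω | A.result r (eqStream x x) ω = Output.bot} (1 : Ω → ℝ) ω) μ :=
    integrable_finsetSum _ fun x _ => hi x x
  have hp : ∀ x, Integrable (fun ω => ∑ y,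
      Set.indicator {ω | A.result r (eqStream x y) ω = Output.bot} (1 : Ω → ℝ) ω) μ :=
    fun x => integrable_finsetSum _ fun y _ => hi x y
  have key := integral_mono (μ := μ) ((hd.const_mul (2 * l)).sub (integrable_const _))
    (integrable_finsetSum _ fun x _ => hp x) fun ω => A.two_mul_card_bot_sub_le r ω l
  have e1 : ∀ x y, ∫ ω, Set.indicator {ω | A.result r (eqStream x y) ω = Output.bot}
      (1 : Ω → ℝ) ω ∂μ = μ.real {ω | A.result r (eqStream x y) ω = Output.bot} :=
    fun x y => integral_indicator_one (hm x y)
  simp only [Pi.sub_apply] at key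
  rw [integral_sub (hd.const_mul _) (integrable_const _), integral_const_mul,
    integral_finsetSum _ fun x _ => hi x x, integral_finsetSum _ fun x _ => hp x] at key
  simp only [integral_finsetSum _ fun y _ => hi _ y, e1, integral_const, probReal_univ,
    one_smul] at key
  exact key

/-- Lower bound for equality with one-sided bounds: if equal inputs are accepted with probability
at least `a` and distinct ones with probability at most `γ`, then the number `2 ^ (2 r s)` of
transcripts is large. -/
theorem StreamingAlgorithm.transcripts_lower_bound (μ : Measure Ω) [IsProbabilityMeasure μ]
    (A : StreamingAlgorithm Ω n s) (r : ℕ) {a γ : ℝ} (ha : 0 < a) (hγ : 0 ≤ γ)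
    (hdiag : ∀ x, a ≤ μ.real {ω | A.result r (eqStream x x) ω = Output.bot})
    (hoff : ∀ x y, x ≠ y → μ.real {ω | A.result r (eqStream x y) ω = Output.bot} ≤ γ) :
    a ^ 2 * 2 ^ n ≤ 2 ^ (2 * r * s) * (a + γ * 2 ^ n) := by
  classical
  set N : ℝ := 2 ^ n with hN
  set K : ℝ := 2 ^ (2 * r * s) with hK
  have hNpos : 0 < N := by positivity
  have hKpos : 0 < K := by positivity
  have hcard : ((Finset.univ : Finset (Fin n → Bool)).card : ℝ) = N := by simp [hN]
  set Q : ℝ := ∑ x, μ.real {ω | A.result r (eqStream x x) ω = Output.bot} with hQ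
  have hQa : a * N ≤ Q := by
    have := Finset.card_nsmul_le_sum (Finset.univ : Finset (Fin n → Bool)) _ a
      fun x _ => hdiag x
    rw [nsmul_eq_mul, hcard] at this
    linarith
  have hQpos : 0 < Q := lt_of_lt_of_le (by positivity) hQa
  have htot : ∑ x, ∑ y, μ.real {ω | A.result r (eqStream x y) ω = Output.bot} ≤
      Q + γ * N ^ 2 := by
    have h : ∀ x y, μ.real {ω | A.result r (eqStream x y) ω = Output.bot} ≤
        (if x = y then μ.real {ω | A.result r (eqStream x x) ω = Output.bot} else 0) + γ := by
      intro x y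
      split_ifs with hxy
      · subst hxy; linarith
      · linarith [hoff x y hxy]
    refine (Finset.sum_le_sum fun x _ => Finset.sum_le_sum fun y _ => h x y).trans ?_
    simp only [Finset.sum_add_distrib, Finset.sum_ite_eq, Finset.mem_univ, if_true,
      Finset.sum_const, nsmul_eq_mul, hcard]
    rw [← hQ]
    linarith [sq N]
  -- `l = Q / K` maximises `2 * l * Q - l ^ 2 * K`, with value `Q ^ 2 / K`.
  have key := (A.two_mul_sum_prob_bot_sub_le μ r (Q / K)).trans htot
  rw [← hQ, ← hK] at key
  have hQ2 : Q ^ 2 ≤ K * (Q + γ * N ^ 2) := by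
    have h : 2 * (Q / K) * Q - (Q / K) ^ 2 * K = Q ^ 2 / K := by field_simp; ring
    rw [h, div_le_iff₀ hKpos] at key
    linarith
  have h1 : Q * (a * N) ≤ K * (Q + γ * N ^ 2) := by nlinarith
  -- Multiply `h1` by `a`, replace `a * N` by `Q` in the term with `γ`, and then cancel `Q`.
  have h2 : Q * (a ^ 2 * N) ≤ Q * (K * (a + γ * N)) := by
    have h3 : a * (Q * (a * N)) ≤ a * (K * (Q + γ * N ^ 2)) := mul_le_mul_of_nonneg_left h1 ha.le
    have h4 : K * γ * N * (a * N) ≤ K * γ * N * Q := mul_le_mul_of_nonneg_left hQa (by positivity)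
    nlinarith
  exact le_of_mul_le_mul_left h2 hQpos

/-- With zero bits there is only one memory state, so the output cannot depend on the stream. -/
theorem StreamingAlgorithm.pos_of_separates (μ : Measure Ω) (A : StreamingAlgorithm Ω n s)
    (r : ℕ) {S T : UpdateStream n}
    (h : μ.real {ω | A.result r S ω = Output.bot} < μ.real {ω | A.result r T ω = Output.bot}) :
    1 ≤ s := by
  by_contra hs
  obtain rfl : s = 0 := by omega
  refine h.ne (congrArg μ.real (Set.ext fun ω => ?_))
  simp only [StreamingAlgorithm.result, Set.mem_ofPred_eq,
    Subsingleton.elim (A.memoryAfter ω S r) (A.memoryAfter ω T r)]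

theorem outputProb_mul_prob_ne_fail (μ : Measure Ω) [IsProbabilityMeasure μ]
    (A : StreamingAlgorithm Ω n s) (r : ℕ) (S : UpdateStream n) :
    outputProb μ A r S Output.bot * (1 - μ.real {ω | A.result r S ω = Output.fail}) =
      μ.real {ω | A.result r S ω = Output.bot} := by
  have hm := A.measurableSet_result r S Output.fail
  have hc : {ω | A.result r S ω ≠ Output.fail} = {ω | A.result r S ω = Output.fail}ᶜ := rfl
  have hsub : {ω | A.result r S ω ≠ Output.fail} ∩ {ω | A.result r S ω = Output.bot} =
      {ω | A.result r S ω = Output.bot} := by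
    refine Set.inter_eq_right.2 fun ω hω => ?_
    simp only [Set.mem_ofPred_eq] at hω ⊢
    simp [hω]
  rw [← probReal_compl_eq_one_sub hm, ← hc, outputProb, measureReal_def, measureReal_def,
    ← ENNReal.toReal_mul, cond_mul_eq_inter (hc ▸ hm.compl), hsub, measureReal_def]

/-! ### From samplers to space bounds. -/

namespace IsApproxSampler

variable {μ : Measure Ω} [IsProbabilityMeasure μ] {A : StreamingAlgorithm Ω n s} {r M m : ℕ}
  {G : ℝ → ℝ≥0} {ε γ δ : ℝ}

/-- One factor `1 - δ` comes from not failing, the other from `⊥` given no failure. -/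
theorem sq_le_prob_bot (h : IsApproxSampler μ A r M m G ε γ δ) (hδ : δ ≤ 1)
    {S : UpdateStream n} (hS : IsTurnstile M m S) (hf : freq S = 0) :
    (1 - δ) ^ 2 ≤ μ.real {ω | A.result r S ω = Output.bot} := by
  rw [← outputProb_mul_prob_ne_fail, sq]
  have h1 := h.le_bot S hS hf
  have h2 := h.fail_le S hS
  exact mul_le_mul h1 (by linarith) (by linarith) (by linarith)

theorem prob_bot_le (h : IsApproxSampler μ A r M m G ε γ δ) {S : UpdateStream n}
    (hS : IsTurnstile M m S) (hf : freq S ≠ 0) :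
    μ.real {ω | A.result r S ω = Output.bot} ≤ γ := by
  rw [← outputProb_mul_prob_ne_fail]
  refine le_trans (mul_le_of_le_one_right measureReal_nonneg ?_) (h.bot_le S hS hf)
  linarith [measureReal_nonneg (μ := μ) (s := {ω | A.result r S ω = Output.fail})]

/-- A sampler on at least one coordinate has at least one bit of memory. -/
theorem one_le_space (h : IsApproxSampler μ A r M m G ε γ δ) (hδ : δ ≤ 1)
    (hγ : γ < (1 - δ) ^ 2) (hM : 1 ≤ M) (hm : 2 * n ≤ m) (hn : 1 ≤ n) : 1 ≤ s := by
  have hne : (fun _ : Fin n => false) ≠ fun _ => true := fun hc => by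
    simpa using congrFun hc ⟨0, hn⟩
  have hoff := h.prob_bot_le (isTurnstile_eqStream hM hm _ _)
    (mt (freq_eqStream_eq_zero_iff _ _).1 hne)
  have hdiag := h.sq_le_prob_bot hδ (isTurnstile_eqStream hM hm _ _)
    ((freq_eqStream_eq_zero_iff (fun _ : Fin n => false) _).2 rfl)
  exact A.pos_of_separates μ r (hoff.trans_lt (hγ.trans_le hdiag))

theorem transcripts_lower_bound (h : IsApproxSampler μ A r M m G ε γ δ) (hδ : δ < 1)
    (hγ : 0 ≤ γ) (hM : 1 ≤ M) (hm : 2 * n ≤ m) :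
    ((1 - δ) ^ 2) ^ 2 * 2 ^ n ≤ 2 ^ (2 * r * s) * ((1 - δ) ^ 2 + γ * 2 ^ n) := by
  refine A.transcripts_lower_bound μ r (pow_pos (by linarith) 2) hγ (fun x => ?_)
    fun x y hxy => ?_
  · exact h.sq_le_prob_bot hδ.le (isTurnstile_eqStream hM hm _ _)
      ((freq_eqStream_eq_zero_iff x x).2 rfl)
  · exact h.prob_bot_le (isTurnstile_eqStream hM hm _ _)
      (mt (freq_eqStream_eq_zero_iff x y).1 hxy)

theorem logb_le_space (h : IsApproxSampler μ A r M m G ε γ (1 / 2)) (hr : 1 ≤ r)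
    (hγ : (2 : ℝ) ^ (-(n : ℝ) / 2) ≤ γ) (hγ4 : γ < 1 / 4) (hM : 1 ≤ M) (hm : 2 * n ≤ m) :
    1 / (10 * (r : ℝ)) * Real.logb 2 (1 / γ) ≤ s := by
  have hr' : (1 : ℝ) ≤ r := by exact_mod_cast hr
  have hγ0 : 0 < γ := lt_of_lt_of_le (by positivity) hγ
  have hn : 1 ≤ n := by
    by_contra hn
    -- For `n = 0` the range of `γ` is empty, as `1 ≤ γ < 1 / 4`.
    obtain rfl : n = 0 := by omega
    norm_num at hγ
    linarith
  have hs : (1 : ℝ) ≤ s := by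
    exact_mod_cast h.one_le_space (by norm_num) (by norm_num; linarith) hM hm hn
  have hγN : 1 ≤ γ * 2 ^ n := by
    have h1 : (2 : ℝ) ^ (-(n : ℝ)) ≤ 2 ^ (-(n : ℝ) / 2) :=
      Real.rpow_le_rpow_of_exponent_le one_le_two (by linarith [n.cast_nonneg (α := ℝ)])
    have h2 : (2 : ℝ) ^ (-(n : ℝ)) * 2 ^ n = 1 := by
      rw [← Real.rpow_natCast, ← Real.rpow_add two_pos]; simp
    rw [← h2]
    exact mul_le_mul_of_nonneg_right (h1.trans hγ) (by positivity)
  have hK := h.transcripts_lower_bound (by norm_num) hγ0.le hM hm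
  -- With `a = 1 / 4` and `1 ≤ γ * 2 ^ n`, the count gives `1 / γ ≤ 20 * K`, and `20 ≤ 2 ^ 5`.
  have hK' : 1 / γ ≤ 2 ^ (2 * r * s + 5) := by
    rw [div_le_iff₀ hγ0, pow_add]
    have hN : (0 : ℝ) < 2 ^ n := by positivity
    have hKpos : (0 : ℝ) < 2 ^ (2 * r * s) := by positivity
    refine le_of_mul_le_mul_right ?_ hN
    nlinarith [mul_le_mul_of_nonneg_left hγN hKpos.le]
  have hL : Real.logb 2 (1 / γ) ≤ 2 * r * s + 5 := by
    have := Real.logb_le_logb_of_le one_lt_two (by positivity) hK'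
    rw [Real.logb_pow, Real.logb_self_eq_one one_lt_two] at this
    push_cast at this
    linarith
  rw [one_div_mul_eq_div, div_le_iff₀ (by positivity)]
  -- Since `r` and `s` are at least `1`, `2 * r * s + 5 ≤ 10 * r * s`.
  nlinarith

end IsApproxSampler

theorem IsApproxSampler.linear_le_space {μ : Measure Ω} [IsProbabilityMeasure μ]
    {A : StreamingAlgorithm Ω n s} {r M m : ℕ} {G : ℝ → ℝ≥0} {ε δ : ℝ}
    (h : IsApproxSampler μ A r M m G ε 0 δ) (hr : 1 ≤ r) (hδ : δ < 1) (hM : 1 ≤ M)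
    (hm : 2 * n ≤ m) :
    1 / (2 * (r : ℝ) + |Real.logb 2 ((1 - δ) ^ 2)|) * n ≤ s := by
  have hr' : (1 : ℝ) ≤ r := by exact_mod_cast hr
  have ha : 0 < (1 - δ) ^ 2 := pow_pos (by linarith) 2
  have hb := abs_nonneg (Real.logb 2 ((1 - δ) ^ 2))
  rw [one_div_mul_eq_div, div_le_iff₀ (by positivity)]
  rcases Nat.eq_zero_or_pos n with rfl | hn
  · simp only [Nat.cast_zero]; positivity
  have hs : (1 : ℝ) ≤ s := by exact_mod_cast h.one_le_space hδ.le ha hM hm hn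
  have hK := h.transcripts_lower_bound hδ le_rfl hM hm
  have hK' : (1 - δ) ^ 2 * 2 ^ n ≤ 2 ^ (2 * r * s) := by
    refine le_of_mul_le_mul_left ?_ ha
    linarith
  have hL : Real.logb 2 ((1 - δ) ^ 2) + n ≤ 2 * r * s := by
    have := Real.logb_le_logb_of_le one_lt_two (by positivity) hK'
    rw [Real.logb_mul ha.ne' (by positivity), Real.logb_pow _ _ n, Real.logb_pow _ _ (2 * r * s),
      Real.logb_self_eq_one one_lt_two, mul_one, mul_one] at this
    exact_mod_cast this
  -- `n ≤ 2 * r * s + |log a|`, and `s ≥ 1` lets the last term be multiplied by `s`.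
  nlinarith [neg_abs_le (Real.logb 2 ((1 - δ) ^ 2))]

end Turnstile

theorem mainTheorem1 (r : ℕ) (hr : 1 ≤ r) :
    (∀ ε₀ : ℝ, 0 ≤ ε₀ → ε₀ < 1 →
      ∃ c : ℝ, 0 < c ∧
        ∀ (n : ℕ) (γ : ℝ), (2 : ℝ) ^ (-(n : ℝ) / 2) ≤ γ → γ < 1 / 4 →
        ∀ G : ℝ → ℝ≥0, G 0 = 0 → (∀ x, x ≠ 0 → 0 < G x) →
        ∀ M m : ℕ, 1 ≤ M → 2 * n ≤ m →
        ∀ (Ω : Type*) [MeasurableSpace Ω] (μ : Measure Ω) [IsProbabilityMeasure μ]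
          (s : ℕ) (A : Turnstile.StreamingAlgorithm Ω n s),
          Turnstile.IsApproxSampler μ A r M m G ε₀ γ (1 / 2) →
          c * min (n : ℝ) (Real.logb 2 (1 / γ)) ≤ (s : ℝ)) ∧
    (∀ δ : ℝ, 0 < δ → δ < 1 →
      ∃ c : ℝ, 0 < c ∧
        ∀ (n : ℕ) (G : ℝ → ℝ≥0), G 0 = 0 → (∀ x, x ≠ 0 → 0 < G x) →
        ∀ M m : ℕ, 1 ≤ M → 2 * n ≤ m →
        ∀ (Ω : Type*) [MeasurableSpace Ω] (μ : Measure Ω) [IsProbabilityMeasure μ]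
          (s : ℕ) (A : Turnstile.StreamingAlgorithm Ω n s),
          Turnstile.IsApproxSampler μ A r M m G 0 0 δ →
          c * (n : ℝ) ≤ (s : ℝ)) := by
  refine ⟨fun ε₀ _ _ => ⟨1 / (10 * (r : ℝ)), by positivity, ?_⟩, fun δ _ hδ =>
    ⟨1 / (2 * (r : ℝ) + |Real.logb 2 ((1 - δ) ^ 2)|), by positivity, ?_⟩⟩
  · intro n γ hγ hγ4 G _ _ M m hM hm Ω _ μ _ s A h
    exact (mul_le_mul_of_nonneg_left (min_le_right _ _) (by positivity)).trans
      (h.logb_le_space hr hγ hγ4 hM hm)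
  · intro n G _ _ M m hM hm Ω _ μ _ s A h
    exact h.linear_le_space hr hδ hM hm
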